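/- Let $M$ be the number of jobs, $B>0$ the total resource budget, and $0<w_1\le w_2\le\cdots\le w_M$ weights. Let $s:[0,B]\to\mathbb{R}$ be a speedup function, that is, $s(0)=0$ and $s$ is continuous, strictly increasing and strictly concave on $[0,B]$ and continuously differentiable on $(0,B]$ (the derivative at $0$ may be finite or $+\infty$). For job sizes $x_1\ge x_2\ge\cdots\ge x_M\ge 0$, a feasible schedule consists of functions $\theta_i(t)\ge 0$ ($t>0$), right-continuous in $t$, with $\sum_{i=1}^M\theta_i(t)\le B$ for all $t>0$, and completion times $T_i\ge 0$ such that $\theta_i(t)=0$ for $t>T_i$ and $\int_0^{T_i}s(\theta_i(t))\,dt=x_i$ for $i=1,\dots,M$. Let $J^*(x_1,\dots,x_M)$ be the minimum of $J=\sum_{i=1}^M w_iT_i$ over all feasible schedules. Then, for fixed $w_1,\dots,w_M$, $s$ and $B$, there are coefficients $a_1<a_2<\cdots<a_M$, not depending on the job sizes, such that for all $x_1\ge x_2\ge\cdots\ge x_M\ge 0$ the minimum is attained and $$J^*(x_1,\dots,x_M)=\sum_{i=1}^M a_i x_i .$$ -/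

import Mathlib

open Set MeasureTheory

/-- `s` is an admissible speedup function on `[0, B]`: `s 0 = 0`, and on `[0, B]` it is strictly
increasing, continuous and strictly concave; it is differentiable on `(0, B]` (one-sidedly at `B`)
with continuous derivative there. The derivative at `0` may be `+∞`, as for `θ ↦ θ ^ p` with
`0 < p < 1`. -/
structure IsSpeedup (B : ℝ) (s : ℝ → ℝ) : Prop where
  map_zero : s 0 = 0
  strictMonoOn : StrictMonoOn s (Icc 0 B)
  continuousOn : ContinuousOn s (Icc 0 B)
  strictConcaveOn : StrictConcaveOn ℝ (Icc 0 B) s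
  differentiableOn : DifferentiableOn ℝ s (Ioc 0 B)
  continuousOn_deriv : ContinuousOn (derivWithin s (Ioc 0 B)) (Ioc 0 B)

/-- The schedule `θ` (`θ i t` is the resource given to job `i` at time `t > 0`) together with the
completion times `T` is feasible for the scheduling problem with budget `B`, speedup function `s`
and job sizes `x`. -/
structure IsFeasible {M : ℕ} (B : ℝ) (s : ℝ → ℝ) (x : Fin M → ℝ)
    (θ : Fin M → ℝ → ℝ) (T : Fin M → ℝ) : Prop where
  /-- allocations are nonnegative -/
  nonneg : ∀ i, ∀ t > 0, 0 ≤ θ i t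
  /-- the allocations respect the budget at all times -/
  budget : ∀ t > 0, ∑ i, θ i t ≤ B
  /-- allocations are right-continuous in time -/
  rightCts : ∀ i, ∀ t > 0, ContinuousWithinAt (θ i) (Ici t) t
  /-- completion times are nonnegative -/
  time_nonneg : ∀ i, 0 ≤ T i
  /-- a job receives nothing after its completion -/
  after : ∀ i, ∀ t > T i, θ i t = 0
  /-- the service received by job `i` up to its completion is exactly its size -/
  service : ∀ i, ∫ t in (0 : ℝ)..(T i), s (θ i t) = x i

/-- The set of values of the objective `∑ w_i T_i` over all feasible schedules. -/
def objectiveValues {M : ℕ} (B : ℝ) (s : ℝ → ℝ) (w x : Fin M → ℝ) : Set ℝ :=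
  {J | ∃ (θ : Fin M → ℝ → ℝ) (T : Fin M → ℝ), IsFeasible B s x θ T ∧ J = ∑ i, w i * T i}

/-! Choose the coefficients so that, for every `k`, the largest value of `∑ a_i s(y_i)` over
divisions of the budget among the first `k` jobs is exactly `W_k = ∑ w_i`, summed over those jobs.
While `k` jobs are unfinished, cost accrues at rate at least `W_k`, and the potential `∑ a_i *
(remaining size)` falls at rate at most `W_k`. Integrating gives the lower bound
`IsFeasible.sum_le`; rearrangement handles any order of completion. Equality holds in
`exists_schedule`, which always serves at a maximizing division: larger coefficients get larger
shares, so jobs finish from the last to the first and the unfinished ones always form an initial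
segment.

The coefficients come one at a time by continuity (`exists_coeff`). They increase strictly because,
by strict concavity, a second copy of the last job raises the maximum by less than the first copy
did (`weightedRate_lt_of_repeat`), while the next weight is no smaller. -/

/-- Divisions of a budget `B` among the first `k` jobs. -/
def allocations (B : ℝ) (k : ℕ) : Set (ℕ → ℝ) :=
  {y | (∀ i, 0 ≤ y i) ∧ (∀ i, k ≤ i → y i = 0) ∧ ∑ i ∈ Finset.range k, y i ≤ B}

/-- The weighted service rate of the first `k` jobs. -/
def weightedRate (s : ℝ → ℝ) (a : ℕ → ℝ) (k : ℕ) (y : ℕ → ℝ) : ℝ :=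
  ∑ i ∈ Finset.range k, a i * s (y i)

lemma allocations.le_budget {B : ℝ} (hB : 0 ≤ B) {k : ℕ} {y : ℕ → ℝ} (hy : y ∈ allocations B k)
    (i : ℕ) : y i ≤ B := by
  obtain ⟨h0, hz, hs⟩ := hy
  by_cases hi : i < k
  · exact (Finset.single_le_sum (f := y) (fun j _ => h0 j) (Finset.mem_range.2 hi)).trans hs
  · rw [hz i (not_lt.1 hi)]; exact hB

lemma allocations.mem_Icc {B : ℝ} (hB : 0 ≤ B) {k : ℕ} {y : ℕ → ℝ} (hy : y ∈ allocations B k)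
    (i : ℕ) : y i ∈ Icc 0 B :=
  ⟨hy.1 i, allocations.le_budget hB hy i⟩

lemma isCompact_allocations {B : ℝ} (hB : 0 ≤ B) (k : ℕ) : IsCompact (allocations B k) := by
  have hc : IsCompact (univ.pi fun _ : ℕ => Icc (0 : ℝ) B) :=
    isCompact_univ_pi fun _ => isCompact_Icc
  refine hc.of_isClosed_subset ?_ fun y hy i _ => allocations.mem_Icc hB hy i
  have h₁ : IsClosed {y : ℕ → ℝ | ∀ i, 0 ≤ y i} := by
    simp only [ofPred_forall]
    exact isClosed_iInter fun i => isClosed_le continuous_const (continuous_apply i)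
  have h₂ : IsClosed {y : ℕ → ℝ | ∀ i, k ≤ i → y i = 0} := by
    simp only [ofPred_forall]
    exact isClosed_iInter fun i => isClosed_iInter fun _ =>
      isClosed_eq (continuous_apply i) continuous_const
  have h₃ : IsClosed {y : ℕ → ℝ | ∑ i ∈ Finset.range k, y i ≤ B} :=
    isClosed_le (by fun_prop) continuous_const
  exact h₁.inter (h₂.inter h₃)

lemma zero_mem_allocations {B : ℝ} (hB : 0 ≤ B) (k : ℕ) : (fun _ => 0) ∈ allocations B k :=
  ⟨fun _ => le_rfl, fun _ _ => rfl, by simpa using hB⟩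

lemma IsSpeedup.nonneg {B : ℝ} {s : ℝ → ℝ} (hs : IsSpeedup B s) {y : ℝ} (hy : y ∈ Icc 0 B) :
    0 ≤ s y := by
  rw [← hs.map_zero]
  exact hs.strictMonoOn.monotoneOn ⟨le_rfl, hy.1.trans hy.2⟩ hy hy.1

lemma IsSpeedup.pos {B : ℝ} {s : ℝ → ℝ} (hs : IsSpeedup B s) {y : ℝ} (hy : y ∈ Ioc 0 B) :
    0 < s y := by
  rw [← hs.map_zero]
  exact hs.strictMonoOn ⟨le_rfl, hy.1.le.trans hy.2⟩ ⟨hy.1.le, hy.2⟩ hy.1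

lemma IsSpeedup.add_le_two_mul {B : ℝ} {s : ℝ → ℝ} (hs : IsSpeedup B s) {u v : ℝ}
    (hu : u ∈ Icc 0 B) (hv : v ∈ Icc 0 B) : s u + s v ≤ 2 * s ((u + v) / 2) := by
  have := hs.strictConcaveOn.concaveOn.2 hu hv (by norm_num : (0 : ℝ) ≤ 1 / 2)
    (by norm_num : (0 : ℝ) ≤ 1 / 2) (by norm_num)
  simp only [smul_eq_mul] at this
  rw [show (1 / 2 * u + 1 / 2 * v) = (u + v) / 2 by ring] at this
  linarith

lemma IsSpeedup.add_lt_two_mul {B : ℝ} {s : ℝ → ℝ} (hs : IsSpeedup B s) {u v : ℝ}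
    (hu : u ∈ Icc 0 B) (hv : v ∈ Icc 0 B) (h : u ≠ v) : s u + s v < 2 * s ((u + v) / 2) := by
  have := hs.strictConcaveOn.2 hu hv h (by norm_num : (0 : ℝ) < 1 / 2)
    (by norm_num : (0 : ℝ) < 1 / 2) (by norm_num)
  simp only [smul_eq_mul] at this
  rw [show (1 / 2 * u + 1 / 2 * v) = (u + v) / 2 by ring] at this
  linarith

lemma weightedRate_congr {s : ℝ → ℝ} {a b y z : ℕ → ℝ} {k : ℕ} (h : ∀ i < k, a i = b i)
    (h' : ∀ i < k, y i = z i) : weightedRate s a k y = weightedRate s b k z :=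
  Finset.sum_congr rfl fun i hi => by
    rw [h i (Finset.mem_range.1 hi), h' i (Finset.mem_range.1 hi)]

lemma weightedRate_update_coeff (s : ℝ → ℝ) (a y : ℕ → ℝ) (k : ℕ) (c : ℝ) :
    weightedRate s (Function.update a k c) (k + 1) y = weightedRate s a k y + c * s (y k) := by
  rw [weightedRate, Finset.sum_range_succ, Function.update_self]
  congr 1
  exact weightedRate_congr (fun i hi => Function.update_of_ne hi.ne _ _) fun _ _ => rfl

lemma continuousOn_weightedRate {B : ℝ} (hB : 0 ≤ B) {s : ℝ → ℝ} (hs : IsSpeedup B s)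
    (a : ℕ → ℝ) (k n : ℕ) : ContinuousOn (weightedRate s a n) (allocations B k) := by
  refine continuousOn_finsetSum _ fun i _ => continuousOn_const.mul ?_
  exact hs.continuousOn.comp (continuous_apply i).continuousOn
    fun y hy => allocations.mem_Icc hB hy i

lemma exists_isMaxOn_weightedRate {B : ℝ} (hB : 0 ≤ B) {s : ℝ → ℝ} (hs : IsSpeedup B s)
    (a : ℕ → ℝ) (k : ℕ) :
    ∃ y ∈ allocations B k, ∀ z ∈ allocations B k, weightedRate s a k z ≤ weightedRate s a k y :=
  (isCompact_allocations hB k).exists_isMaxOn ⟨_, zero_mem_allocations hB k⟩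
    (continuousOn_weightedRate hB hs a k k)

/-! ### Construction of the coefficients -/

/-- Raising the last coefficient slightly keeps the weighted rate below a bound it does not
attain. -/
lemma exists_gt_weightedRate_le {B : ℝ} (hB : 0 < B) {s : ℝ → ℝ} (hs : IsSpeedup B s)
    (a : ℕ → ℝ) (k : ℕ) {c W : ℝ}
    (h : ∀ y ∈ allocations B (k + 1), weightedRate s a k y + c * s (y k) < W) :
    ∃ c' > c, ∀ y ∈ allocations B (k + 1), weightedRate s a k y + c' * s (y k) ≤ W := by
  obtain ⟨y, hy, hmax⟩ := exists_isMaxOn_weightedRate hB.le hs (Function.update a k c) (k + 1)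
  simp only [weightedRate_update_coeff] at hmax
  have hsB : 0 < s B := hs.pos ⟨hB, le_rfl⟩
  have hlt := h y hy
  set V := weightedRate s a k y + c * s (y k) with hV
  -- `V < W` is the maximum for `c`. Since `s (z k) ≤ s B`, this increment adds at most `W - V`.
  refine ⟨c + (W - V) / s B, lt_add_of_pos_right _ (div_pos (by linarith) hsB), fun z hz => ?_⟩
  have h1 := hmax z hz
  have h2 : (W - V) / s B * s (z k) ≤ W - V := by
    have hz' := allocations.mem_Icc hB.le hz k
    calc (W - V) / s B * s (z k) ≤ (W - V) / s B * s B :=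
          mul_le_mul_of_nonneg_left
            (hs.strictMonoOn.monotoneOn hz' ⟨hB.le, le_rfl⟩ hz'.2)
            (div_nonneg (by linarith) hsB.le)
      _ = W - V := div_mul_cancel₀ _ hsB.ne'
  linarith

/-- The last coefficient can be chosen so that the maximal weighted rate is exactly `W`. -/
lemma exists_coeff {B : ℝ} (hB : 0 < B) {s : ℝ → ℝ} (hs : IsSpeedup B s)
    (a : ℕ → ℝ) (k : ℕ) {c W : ℝ}
    (h : ∀ y ∈ allocations B (k + 1), weightedRate s a k y + c * s (y k) < W) :
    ∃ c' > c, IsGreatest ((fun y => weightedRate s a k y + c' * s (y k)) ''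
      allocations B (k + 1)) W := by
  have hsB : 0 < s B := hs.pos ⟨hB, le_rfl⟩
  set C : Set ℝ := {c | ∀ y ∈ allocations B (k + 1), weightedRate s a k y + c * s (y k) ≤ W}
    with hC
  obtain ⟨c₁, hc₁, hc₁C⟩ := exists_gt_weightedRate_le hB hs a k h
  have hbdd : BddAbove C := by
    refine ⟨W / s B, fun d hd => ?_⟩
    -- Giving the whole budget to job `k` shows `d * s B ≤ W`.
    have hy : Function.update (fun _ : ℕ => (0 : ℝ)) k B ∈ allocations B (k + 1) := by
      refine ⟨fun i => ?_, fun i hi => ?_, ?_⟩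
      · by_cases hi : i = k
        · subst hi; simpa using hB.le
        · simp [hi]
      · simp [show i ≠ k by omega]
      · simp [Finset.sum_update_of_mem]
    have h1 := hd _ hy
    have h2 : weightedRate s a k (Function.update (fun _ : ℕ => (0 : ℝ)) k B) = 0 := by
      refine Finset.sum_eq_zero fun i hi => ?_
      simp [(Finset.mem_range.1 hi).ne, hs.map_zero]
    rw [h2, zero_add, Function.update_self] at h1
    rwa [le_div_iff₀ hsB]
  have hclosed : IsClosed C := by
    simp only [hC, ofPred_forall]
    exact isClosed_iInter fun y => isClosed_iInter fun _ =>
      isClosed_le (by fun_prop) continuous_const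
  have hmem : sSup C ∈ C := hclosed.csSup_mem ⟨c₁, hc₁C⟩ hbdd
  refine ⟨sSup C, hc₁.trans_le (le_csSup hbdd hc₁C), ?_, ?_⟩
  · by_contra hne
    obtain ⟨c₂, hc₂, hc₂C⟩ := exists_gt_weightedRate_le hB hs a k (c := sSup C) (W := W)
      fun y hy => lt_of_le_of_ne (hmem y hy) fun h => hne ⟨y, hy, h⟩
    exact absurd (le_csSup hbdd hc₂C) (not_le.2 hc₂)
  · rintro _ ⟨y, hy, rfl⟩
    exact hmem y hy

/-- Doubling the last job raises the maximal weighted rate by less than adding it did. -/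
lemma weightedRate_lt_of_repeat {B : ℝ} (hB : 0 < B) {s : ℝ → ℝ} (hs : IsSpeedup B s)
    {a : ℕ → ℝ} {k : ℕ} (ha : ∀ i ≤ k, 0 < a i) {V v : ℝ} (hv : 0 < v)
    (h₀ : IsGreatest (weightedRate s a k '' allocations B k) V)
    (h₁ : IsGreatest (weightedRate s a (k + 1) '' allocations B (k + 1)) (V + v))
    {y : ℕ → ℝ} (hy : y ∈ allocations B (k + 2)) :
    weightedRate s a (k + 1) y + a k * s (y (k + 1)) < V + v + v := by
  by_contra! hcon
  obtain ⟨z, hz, hzV⟩ := h₀.1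
  have hyI := allocations.mem_Icc hB.le hy
  have hzI := allocations.mem_Icc hB.le hz
  have hysum : ∑ i ∈ Finset.range k, y i + y k + y (k + 1) ≤ B := by
    have := hy.2.2
    rwa [Finset.sum_range_succ, Finset.sum_range_succ] at this
  have bound : ∀ (m : ℕ → ℝ) (u : ℝ), (∀ i, 0 ≤ m i) → 0 ≤ u →
      ∑ i ∈ Finset.range k, m i + u ≤ B → weightedRate s a k m + a k * s u ≤ V + v := by
    intro m u hm hu hsum
    have hmem : (fun i => if i < k then m i else if i = k then u else 0) ∈
        allocations B (k + 1) := by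
      refine ⟨fun i => ?_, fun i hi => ?_, ?_⟩
      · dsimp only; split_ifs
        exacts [hm i, hu, le_rfl]
      · dsimp only; rw [if_neg (by omega), if_neg (by omega)]
      · rw [Finset.sum_range_succ]
        simp only [lt_irrefl, if_false, if_true]
        refine le_trans (le_of_eq ?_) hsum
        congr 1
        exact Finset.sum_congr rfl fun i hi => by rw [if_pos (Finset.mem_range.1 hi)]
    refine le_trans (le_of_eq ?_) (h₁.2 ⟨_, hmem, rfl⟩)
    rw [weightedRate, weightedRate, Finset.sum_range_succ]
    simp only [lt_irrefl, if_false, if_true]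
    congr 1
    exact Finset.sum_congr rfl fun i hi => by rw [if_pos (Finset.mem_range.1 hi)]
  -- Average `z`, optimal for `k` jobs, with `y`, letting one job `k` stand for both copies. By
  -- concavity this averaged division has rate at least `V + v`, which is also the upper bound, so
  -- every concavity inequality used is an equality.
  have hmid := bound (fun i => (y i + z i) / 2) ((y k + y (k + 1)) / 2)
    (fun i => by have := (hyI i).1; have := (hzI i).1; positivity)
    (by have := (hyI k).1; have := (hyI (k + 1)).1; positivity)
    (by
      have := hz.2.2
      rw [← Finset.sum_div, Finset.sum_add_distrib]
      linarith)
  rw [weightedRate, Finset.sum_range_succ] at hcon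
  have hterm : ∀ i ∈ Finset.range k,
      a i * s (y i) + a i * s (z i) ≤ 2 * (a i * s ((y i + z i) / 2)) := fun i hi => by
    have := mul_le_mul_of_nonneg_left (hs.add_le_two_mul (hyI i) (hzI i))
      (ha i (Finset.mem_range.1 hi).le).le
    linarith
  have hsumle := Finset.sum_le_sum hterm
  rw [Finset.sum_add_distrib, ← Finset.mul_sum] at hsumle
  have hlast := mul_le_mul_of_nonneg_left (hs.add_le_two_mul (hyI k) (hyI (k + 1)))
    (ha k le_rfl).le
  simp only [weightedRate] at hmid hzV
  have huu : y k = y (k + 1) := by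
    by_contra hne
    have := mul_lt_mul_of_pos_left (hs.add_lt_two_mul (hyI k) (hyI (k + 1)) hne) (ha k le_rfl)
    linarith
  have hyz : ∀ i < k, y i = z i := by
    intro i hi
    by_contra hne
    have := Finset.sum_lt_sum hterm ⟨i, Finset.mem_range.2 hi, by
      have := mul_lt_mul_of_pos_left (hs.add_lt_two_mul (hyI i) (hzI i) hne) (ha i hi.le)
      linarith⟩
    rw [Finset.sum_add_distrib, ← Finset.mul_sum] at this
    linarith
  have hyV : ∑ i ∈ Finset.range k, a i * s (y i) = V := by
    rw [← hzV]
    exact Finset.sum_congr rfl fun i hi => by rw [hyz i (Finset.mem_range.1 hi)]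
  rw [hyV, ← huu] at hcon
  have hpos : 0 < y k := by
    refine lt_of_le_of_ne (hyI k).1 fun h0 => ?_
    rw [← h0, hs.map_zero] at hcon
    linarith
  -- The two copies get equal positive shares, each contributing at least `v`. Handing both shares
  -- to a single job `k` then exceeds the maximum `V + v`.
  have hslack := bound y (y k + y (k + 1)) hy.1 (by linarith [(hyI (k + 1)).1]) (by linarith)
  rw [weightedRate, hyV, ← huu] at hslack
  have hsumI : y k + y k ∈ Icc 0 B :=
    ⟨by linarith, by
      have : 0 ≤ ∑ i ∈ Finset.range k, y i := Finset.sum_nonneg fun i _ => hy.1 i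
      linarith⟩
  have := mul_lt_mul_of_pos_left (hs.strictMonoOn (hyI k) hsumI (by linarith)) (ha k le_rfl)
  linarith

/-- Coefficients for which, for every number `k ≤ n` of unfinished jobs, the maximal weighted rate
equals the rate at which those jobs accrue cost. -/
lemma exists_coefficients {B : ℝ} (hB : 0 < B) {s : ℝ → ℝ} (hs : IsSpeedup B s)
    {w : ℕ → ℝ} (hw_pos : ∀ i, 0 < w i) (hw : Monotone w) (n : ℕ) :
    ∃ a : ℕ → ℝ, (∀ i < n, 0 < a i) ∧ (∀ i, i + 1 < n → a i < a (i + 1)) ∧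
      ∀ k ≤ n, IsGreatest (weightedRate s a k '' allocations B k)
        (∑ i ∈ Finset.range k, w i) := by
  induction n with
  | zero =>
    refine ⟨fun _ => 0, by simp, by simp, fun k hk => ?_⟩
    obtain rfl : k = 0 := by omega
    refine ⟨⟨_, zero_mem_allocations hB.le 0, by simp [weightedRate]⟩, ?_⟩
    rintro _ ⟨y, -, rfl⟩
    simp [weightedRate]
  | succ n ih =>
    obtain ⟨a, hpos, hmono, hmax⟩ := ih
    -- `c₀` is the previous coefficient, or `0` for the first job; it is too small to reach the new
    -- total weight.
    obtain ⟨c₀, hc₀, hlast, hlt⟩ : ∃ c₀ : ℝ, 0 ≤ c₀ ∧ (∀ i, i + 1 = n → a i = c₀) ∧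
        ∀ y ∈ allocations B (n + 1),
          weightedRate s a n y + c₀ * s (y n) < ∑ i ∈ Finset.range (n + 1), w i := by
      rcases n with _ | n
      · exact ⟨0, le_rfl, by simp, fun y _ => by simpa [weightedRate] using hw_pos 0⟩
      · refine ⟨a n, (hpos n (by omega)).le, fun i hi => by
          rw [Nat.succ_injective hi], fun y hy => ?_⟩
        have h1 := hmax (n + 1) le_rfl
        rw [Finset.sum_range_succ] at h1
        have := weightedRate_lt_of_repeat hB hs (fun i hi => hpos i (by omega)) (hw_pos n)
          (hmax n (by omega)) h1 hy
        rw [Finset.sum_range_succ, Finset.sum_range_succ]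
        have := hw (Nat.le_succ n)
        simp only [Nat.succ_eq_add_one] at this
        linarith
    obtain ⟨c, hc, hgreat⟩ := exists_coeff hB hs a n hlt
    have hne : ∀ i < n, Function.update a n c i = a i := fun i hi =>
      Function.update_of_ne hi.ne _ _
    refine ⟨Function.update a n c, fun i hi => ?_, fun i hi => ?_, fun k hk => ?_⟩
    · rcases Nat.lt_succ_iff_lt_or_eq.1 hi with h | rfl
      · rw [hne i h]; exact hpos i h
      · rw [Function.update_self]; linarith
    · rw [hne i (by omega)]
      rcases Nat.lt_succ_iff_lt_or_eq.1 hi with h | h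
      · rw [hne _ h]; exact hmono i h
      · rw [h, Function.update_self, hlast i h]; exact hc
    · rcases Nat.le_succ_iff.1 hk with h | rfl
      · have : weightedRate s (Function.update a n c) k = weightedRate s a k := by
          funext y
          exact weightedRate_congr (fun i hi => hne i (by omega)) fun _ _ => rfl
        rw [this]; exact hmax k h
      · have : weightedRate s (Function.update a n c) (n + 1) =
            fun y => weightedRate s a n y + c * s (y n) :=
          funext fun y => weightedRate_update_coeff s a y n c
        rw [Nat.succ_eq_add_one, this]; exact hgreat

/-- An allocation maximizing the weighted rate favours jobs with larger coefficients. -/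
lemma le_of_isGreatest_weightedRate {B : ℝ} (hB : 0 < B) {s : ℝ → ℝ} (hs : IsSpeedup B s)
    {a : ℕ → ℝ} {k : ℕ} {y : ℕ → ℝ} (hy : y ∈ allocations B k)
    (hmax : ∀ z ∈ allocations B k, weightedRate s a k z ≤ weightedRate s a k y)
    {i j : ℕ} (hi : i < k) (hj : j < k) (hij : a i < a j) : y i ≤ y j := by
  by_contra! hlt
  have hne : i ≠ j := by rintro rfl; exact lt_irrefl _ hij
  have hswap : ∀ n, n < k ↔ Equiv.swap i j n < k := by
    intro n
    by_cases h1 : n = i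
    · subst h1; simp [hi, hj]
    by_cases h2 : n = j
    · subst h2; simp [hi, hj]
    rw [Equiv.swap_apply_of_ne_of_ne h1 h2]
  have hmem : y ∘ Equiv.swap i j ∈ allocations B k := by
    refine ⟨fun n => hy.1 _, fun n hn => hy.2.1 _ ?_, ?_⟩
    · by_contra! h
      have := (hswap n).2 h
      omega
    · refine le_trans (le_of_eq ?_) hy.2.2
      exact Finset.sum_equiv (Equiv.swap i j) (fun n => by simpa using hswap n) fun n _ => rfl
  have h := hmax _ hmem
  have hdiff : weightedRate s a k (y ∘ Equiv.swap i j) - weightedRate s a k y =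
      (a j - a i) * (s (y i) - s (y j)) := by
    rw [weightedRate, weightedRate, ← Finset.sum_sub_distrib,
      ← Finset.sum_subset (s₁ := {i, j}), Finset.sum_pair hne]
    · simp only [Function.comp, Equiv.swap_apply_left, Equiv.swap_apply_right]; ring
    · intro n hn
      rcases Finset.mem_insert.1 hn with rfl | hn
      · simpa using hi
      · rw [Finset.mem_singleton.1 hn]; simpa using hj
    · intro n _ hn
      simp only [Finset.mem_insert, Finset.mem_singleton, not_or] at hn
      simp [Equiv.swap_apply_of_ne_of_ne hn.1 hn.2]
  have hI := allocations.mem_Icc hB.le hy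
  have := mul_pos (sub_pos.2 hij) (sub_pos.2 (hs.strictMonoOn (hI j) (hI i) hlt))
  linarith

/-! ### Measurability and integrability of service rates -/

/-- Sampling `f` at the next point of a grid of mesh `1 / (n + 1)` strictly to the right of `t`
gives measurable functions, which converge to `f` by right-continuity. -/
lemma measurable_indicator_Ioi_of_rightCts {f : ℝ → ℝ}
    (hf : ∀ t > 0, ContinuousWithinAt f (Ici t) t) : Measurable ((Ioi 0).indicator f) := by
  set g := (Ioi (0 : ℝ)).indicator f with hg
  let u : ℕ → ℝ → ℝ := fun n t => ((⌊((n : ℝ) + 1) * t⌋ : ℝ) + 1) / ((n : ℝ) + 1)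
  have hu_gt : ∀ n t, t < u n t := fun n t => by
    have := Int.lt_floor_add_one (((n : ℝ) + 1) * t)
    rw [lt_div_iff₀ (by positivity)]
    linarith
  have hu_le : ∀ n t, u n t ≤ t + 1 / ((n : ℝ) + 1) := fun n t => by
    have := Int.floor_le (((n : ℝ) + 1) * t)
    have hn : (0 : ℝ) < (n : ℝ) + 1 := by positivity
    rw [div_le_iff₀ hn, show (t + 1 / ((n : ℝ) + 1)) * ((n : ℝ) + 1) = ((n : ℝ) + 1) * t + 1 by
      field_simp]
    linarith
  have hu_lim : ∀ t, Filter.Tendsto (fun n => u n t) Filter.atTop (nhds t) := fun t => by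
    refine tendsto_of_tendsto_of_tendsto_of_le_of_le tendsto_const_nhds ?_
      (fun n => (hu_gt n t).le) (fun n => hu_le n t)
    simpa using tendsto_const_nhds.add (tendsto_one_div_add_atTop_nhds_zero_nat (𝕜 := ℝ))
  have hmeas : ∀ n, Measurable fun t => (Ioi (0 : ℝ)).indicator (fun t => f (u n t)) t :=
    fun n => by
      refine Measurable.indicator ?_ measurableSet_Ioi
      have h1 : Measurable fun t : ℝ => ⌊((n : ℝ) + 1) * t⌋ :=
        Int.measurable_floor.comp (measurable_const.mul measurable_id)
      exact (measurable_from_top (f := fun m : ℤ => f (((m : ℝ) + 1) / ((n : ℝ) + 1)))).comp h1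
  refine measurable_of_tendsto_metrizable hmeas (tendsto_pi_nhds.2 fun t => ?_)
  by_cases ht : 0 < t
  · simp only [hg, indicator_of_mem (mem_Ioi.2 ht)]
    exact (hf t ht).tendsto.comp (tendsto_nhdsWithin_iff.2
      ⟨hu_lim t, Filter.Eventually.of_forall fun n => (hu_gt n t).le⟩)
  · simp only [hg, indicator_of_notMem (show t ∉ Ioi (0 : ℝ) from ht)]
    exact tendsto_const_nhds

lemma IsSpeedup.intervalIntegrable_comp {B : ℝ} {s : ℝ → ℝ} (hs : IsSpeedup B s)
    {f : ℝ → ℝ} (hf : ∀ t > 0, ContinuousWithinAt f (Ici t) t)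
    (hfI : ∀ t > 0, f t ∈ Icc 0 B) {T : ℝ} (hT : 0 ≤ T) :
    IntervalIntegrable (fun t => s (f t)) volume 0 T := by
  have hmeas : Measurable ((Ioi 0).indicator fun t => s (f t)) :=
    measurable_indicator_Ioi_of_rightCts fun t ht =>
      (hs.continuousOn _ (hfI t ht)).comp (hf t ht) fun r hr =>
        hfI r (lt_of_lt_of_le ht hr)
  rw [intervalIntegrable_iff_integrableOn_Ioc_of_le hT]
  have h : IntegrableOn ((Ioi 0).indicator fun t => s (f t)) (Ioc 0 T) := by
    refine Measure.integrableOn_of_bounded (M := s B) (by simp) hmeas.aestronglyMeasurable ?_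
    refine (ae_restrict_iff' measurableSet_Ioc).2 (Filter.Eventually.of_forall fun t ht => ?_)
    have hI := hfI t ht.1
    rw [indicator_of_mem (mem_Ioi.2 ht.1), Real.norm_of_nonneg (hs.nonneg hI)]
    exact hs.strictMonoOn.monotoneOn hI ⟨hI.1.trans hI.2, le_rfl⟩ hI.2
  exact h.congr_fun (fun t ht => indicator_of_mem (mem_Ioi.2 ht.1) _) measurableSet_Ioc

lemma IsFeasible.mem_Icc {M : ℕ} {B : ℝ} {s : ℝ → ℝ} {x : Fin M → ℝ} {θ : Fin M → ℝ → ℝ}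
    {T : Fin M → ℝ} (h : IsFeasible B s x θ T) (i : Fin M) {t : ℝ} (ht : 0 < t) :
    θ i t ∈ Icc 0 B :=
  ⟨h.nonneg i t ht, (Finset.single_le_sum (f := fun j => θ j t) (fun j _ => h.nonneg j t ht)
    (Finset.mem_univ i)).trans (h.budget t ht)⟩

/-! ### Lower bound for all feasible schedules -/

lemma exists_lt_iff_of_lowerSet {M : ℕ} {p : Fin M → Prop}
    (hp : ∀ i j, i ≤ j → p j → p i) : ∃ k ≤ M, ∀ j : Fin M, p j ↔ (j : ℕ) < k := by
  classical
  have hex : ∃ n, ∀ h : n < M, ¬ p ⟨n, h⟩ := ⟨M, fun h => absurd h (lt_irrefl _)⟩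
  refine ⟨Nat.find hex, Nat.find_min' hex fun h => absurd h (lt_irrefl _), fun j => ?_⟩
  constructor
  · intro hj
    by_contra! hle
    exact Nat.find_spec hex (hle.trans_lt j.2) (hp _ j hle hj)
  · intro hj
    have := Nat.find_min hex hj
    push Not at this
    exact this.2

lemma sum_ite_lt_fin {M k : ℕ} (hk : k ≤ M) (f : ℕ → ℝ) :
    ∑ j : Fin M, (if (j : ℕ) < k then f j else 0) = ∑ j ∈ Finset.range k, f j := by
  rw [Fin.sum_univ_eq_sum_range (fun n => if n < k then f n else 0) M, ← Finset.sum_filter]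
  congr 1
  ext n
  simp only [Finset.mem_filter, Finset.mem_range]
  omega

/-- Every feasible schedule costs at least the linear functional of the job sizes given by
coefficients that bound the weighted rate of every initial set of jobs. -/
lemma IsFeasible.sum_le {M : ℕ} {B : ℝ} {s : ℝ → ℝ} (hs : IsSpeedup B s)
    {w a : ℕ → ℝ} (hw : Monotone w) (ha : Monotone fun i : Fin M => a i)
    (hmax : ∀ k ≤ M, ∀ y ∈ allocations B k,
      weightedRate s a k y ≤ ∑ i ∈ Finset.range k, w i)
    {x : Fin M → ℝ} (hx : Antitone x) {θ : Fin M → ℝ → ℝ} {T : Fin M → ℝ}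
    (h : IsFeasible B s x θ T) : ∑ i : Fin M, a i * x i ≤ ∑ i : Fin M, w i * T i := by
  -- Order jobs by decreasing completion time, so that the unfinished ones are always an initial
  -- segment. Re-indexing only tightens the claim: `a` and `x`, like `w` and `T ∘ π`, are oppositely
  -- ordered, which minimizes the sum of products.
  set π : Equiv.Perm (Fin M) := Tuple.sort fun i => -T i with hπ
  have hanti : Antitone (T ∘ π) := fun i j hij => by
    have := Tuple.monotone_sort (fun i => -T i) hij
    simpa using this
  have hax : ∑ i : Fin M, a i * x i ≤ ∑ i : Fin M, a i * x (π i) :=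
    (ha.antivary hx).sum_mul_le_sum_mul_comp_perm
  have hwT : ∑ i : Fin M, w i * T (π i) ≤ ∑ i : Fin M, w i * T i := by
    have hwm : Monotone fun i : Fin M => w i := fun i j hij => hw hij
    have := (hwm.antivary hanti).sum_mul_le_sum_mul_comp_perm (σ := π⁻¹)
    simpa using this
  refine hax.trans (le_trans ?_ hwT)
  have hint : ∀ i, Integrable ((Ioc 0 (T i)).indicator fun t => s (θ i t)) := fun i => by
    rw [integrable_indicator_iff measurableSet_Ioc,
      ← intervalIntegrable_iff_integrableOn_Ioc_of_le (h.time_nonneg i)]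
    exact hs.intervalIntegrable_comp (h.rightCts i) (fun t ht => h.mem_Icc i ht)
      (h.time_nonneg i)
  have hint1 : ∀ i, Integrable ((Ioc 0 (T i)).indicator fun _ => (1 : ℝ)) := fun i => by
    rw [integrable_indicator_iff measurableSet_Ioc]
    exact integrableOn_const (by simp)
  have hxi : ∀ i, x i = ∫ t, (Ioc 0 (T i)).indicator (fun t => s (θ i t)) t := fun i => by
    rw [integral_indicator measurableSet_Ioc, ← h.service i,
      intervalIntegral.integral_of_le (h.time_nonneg i)]
  have hTi : ∀ i, T i = ∫ t, (Ioc 0 (T i)).indicator (fun _ => (1 : ℝ)) t := fun i => by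
    rw [integral_indicator measurableSet_Ioc]
    simp [h.time_nonneg i]
  calc ∑ i : Fin M, a i * x (π i)
      = ∫ t, ∑ i : Fin M, a i * (Ioc 0 (T (π i))).indicator (fun t => s (θ (π i) t)) t := by
        rw [integral_finsetSum _ fun i _ => (hint (π i)).const_mul _]
        exact Finset.sum_congr rfl fun i _ => by rw [integral_const_mul, ← hxi]
    _ ≤ ∫ t, ∑ i : Fin M, w i * (Ioc 0 (T (π i))).indicator (fun _ => (1 : ℝ)) t := by
        refine integral_mono (integrable_finsetSum _ fun i _ => (hint (π i)).const_mul _)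
          (integrable_finsetSum _ fun i _ => (hint1 (π i)).const_mul _) fun t => ?_
        by_cases ht : 0 < t
        swap
        · simp [indicator, ht]
        obtain ⟨k, hk, hact⟩ := exists_lt_iff_of_lowerSet (p := fun j : Fin M => t ≤ T (π j))
          fun i j hij hj => hj.trans (hanti hij)
        set y : ℕ → ℝ := fun n => if hn : n < M then (if n < k then θ (π ⟨n, hn⟩) t else 0)
          else 0 with hy
        have hyj : ∀ j : Fin M, y j = if (j : ℕ) < k then θ (π j) t else 0 := fun j => by
          simp [hy]
        have hmem : y ∈ allocations B k := by
          refine ⟨fun n => ?_, fun n hn => ?_, ?_⟩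
          · simp only [hy]
            split_ifs
            exacts [h.nonneg _ t ht, le_rfl, le_rfl]
          · simp only [hy]
            split_ifs
            exacts [absurd ‹n < k› (not_lt.2 hn), rfl, rfl]
          · rw [← sum_ite_lt_fin hk]
            refine le_trans ?_ (h.budget t ht)
            rw [← Equiv.sum_comp π fun i => θ i t]
            refine Finset.sum_le_sum fun j _ => ?_
            by_cases hj : (j : ℕ) < k
            · rw [if_pos hj, hyj, if_pos hj]
            · rw [if_neg hj]; exact h.nonneg _ t ht
        have hle := hmax k hk y hmem
        rw [weightedRate, ← sum_ite_lt_fin hk, ← sum_ite_lt_fin hk w] at hle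
        refine le_trans (le_of_eq ?_) (hle.trans (le_of_eq ?_))
        · refine Finset.sum_congr rfl fun j _ => ?_
          rw [hyj]
          by_cases hj : (j : ℕ) < k
          · simp [indicator, ht, hj, (hact j).2 hj]
          · simp [indicator, hj, mt (hact j).1 hj]
        · refine Finset.sum_congr rfl fun j _ => ?_
          by_cases hj : (j : ℕ) < k
          · simp [indicator, ht, hj, (hact j).2 hj]
          · simp [indicator, hj, mt (hact j).1 hj]
    _ = ∑ i : Fin M, w i * T (π i) := by
        rw [integral_finsetSum _ fun i _ => (hint1 (π i)).const_mul _]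
        exact Finset.sum_congr rfl fun i _ => by rw [integral_const_mul, ← hTi]

/-! ### An optimal schedule -/

/-- Serving the unfinished jobs at the rates that maximize the weighted rate attains the linear
functional of the job sizes. -/
lemma exists_schedule {M : ℕ} {B : ℝ} (hB : 0 < B) {s : ℝ → ℝ} (hs : IsSpeedup B s)
    {w a : ℕ → ℝ} (hw_pos : ∀ i, 0 < w i) (ha : ∀ i j, i < j → j < M → a i < a j)
    (hmax : ∀ k ≤ M, IsGreatest (weightedRate s a k '' allocations B k)
      (∑ i ∈ Finset.range k, w i)) (k : ℕ) (hk : k ≤ M) :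
    ∀ x : Fin M → ℝ, (∀ i, 0 ≤ x i) → Antitone x → (∀ i : Fin M, k ≤ i → x i = 0) →
      ∃ (θ : Fin M → ℝ → ℝ) (T : Fin M → ℝ),
        (∀ i t, 0 ≤ θ i t) ∧ (∀ t, ∑ i, θ i t ≤ B) ∧
        (∀ i t, ContinuousWithinAt (θ i) (Ici t) t) ∧ (∀ i, 0 ≤ T i) ∧
        (∀ i, ∀ t ≥ T i, θ i t = 0) ∧ (∀ i, ∫ t in (0 : ℝ)..(T i), s (θ i t) = x i) ∧
        (∀ i : Fin M, k ≤ i → T i = 0) ∧ ∑ i : Fin M, w i * T i = ∑ i : Fin M, a i * x i := by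
  induction k with
  | zero =>
    intro x _ _ hx0
    have hx : ∀ i, x i = 0 := fun i => hx0 i (Nat.zero_le _)
    exact ⟨fun _ _ => 0, fun _ => 0, by simp, by simpa using hB.le,
      fun _ _ => continuousWithinAt_const, by simp, by simp, by simp [hx], by simp, by simp [hx]⟩
  | succ k ih =>
    intro x hx hxa hxz
    obtain ⟨⟨y, hy, hyW⟩, hyub⟩ := hmax (k + 1) hk
    have hyI := allocations.mem_Icc hB.le hy
    have hymono : ∀ i j, i ≤ j → j < k + 1 → y i ≤ y j := fun i j hij hj => by
      rcases hij.lt_or_eq with h | rfl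
      · exact le_of_isGreatest_weightedRate hB hs hy
          (fun z hz => (hyub ⟨z, hz, rfl⟩).trans hyW.ge) (by omega) hj (ha i j h (by omega))
      · exact le_rfl
    -- Otherwise all shares vanish by monotonicity, while the maximum is positive.
    have hyk : 0 < y k := by
      refine lt_of_le_of_ne (hyI k).1 fun h0 => ?_
      have hz : weightedRate s a (k + 1) y = 0 := by
        refine Finset.sum_eq_zero fun i hi => ?_
        have hi' := Finset.mem_range.1 hi
        have := hymono i k (by omega) (by omega)
        rw [le_antisymm (this.trans h0.ge) (hyI i).1, hs.map_zero, mul_zero]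
      have : 0 < ∑ i ∈ Finset.range (k + 1), w i :=
        Finset.sum_pos (fun i _ => hw_pos i) ⟨0, by simp⟩
      linarith
    have hsk : 0 < s (y k) := hs.pos ⟨hyk, (hyI k).2⟩
    have hsmono : ∀ i j, i ≤ j → j < k + 1 → s (y i) ≤ s (y j) := fun i j hij hj =>
      hs.strictMonoOn.monotoneOn (hyI i) (hyI j) (hymono i j hij hj)
    set κ : Fin M := ⟨k, hk⟩ with hκ
    -- The time job `k` needs at constant share `y k`. The remaining sizes `x'` stay nonnegative and
    -- ordered, because earlier jobs are larger and served no faster.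
    set d := x κ / s (y k) with hd
    have hd0 : 0 ≤ d := div_nonneg (hx κ) hsk.le
    have hdk : d * s (y k) = x κ := div_mul_cancel₀ _ hsk.ne'
    have hyz : ∀ i : ℕ, k < i → y i = 0 := fun i hi => hy.2.1 i hi
    set x' : Fin M → ℝ := fun i => x i - d * s (y i) with hx'
    have hx'z : ∀ i : Fin M, k ≤ i → x' i = 0 := fun i hi => by
      rcases hi.lt_or_eq with h | h
      · simp [hx', hyz i h, hs.map_zero, hxz i h]
      · have : i = κ := Fin.ext h.symm
        subst this
        simp [hx', hκ] at hdk ⊢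
        linarith
    have hle : ∀ i j : Fin M, i ≤ j → (j : ℕ) ≤ k → x' j ≤ x' i := fun i j hij hj => by
      have h1 := hxa hij
      have h2 := mul_le_mul_of_nonneg_left (hsmono i j hij (by omega)) hd0
      simp only [hx']
      linarith
    have hx'0 : ∀ i, 0 ≤ x' i := fun i => by
      by_cases hi : k ≤ (i : ℕ)
      · exact (hx'z i hi).ge
      · rw [← hx'z κ le_rfl]
        exact hle i κ (show (i : ℕ) ≤ k by omega) le_rfl
    have hx'a : Antitone x' := fun i j hij => by
      by_cases hj : k ≤ (j : ℕ)
      · rw [hx'z j hj]; exact hx'0 i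
      · exact hle i j hij (by omega)
    obtain ⟨θ, T, hθ0, hθB, hθc, hT0, hθT, hserv, hTz, hobj⟩ :=
      ih (by omega) x' hx'0 hx'a hx'z
    -- Hold the division `y` up to time `d`, then run the schedule for `x'` delayed by `d`.
    set θ' : Fin M → ℝ → ℝ := fun i t => if t < d then y i else θ i (t - d) with hθ'
    set T' : Fin M → ℝ := fun i => T i + if (i : ℕ) < k + 1 then d else 0 with hT'
    have hcts : ∀ i t, ContinuousWithinAt (θ' i) (Ici t) t := fun i t => by
      by_cases ht : t < d
      · refine (continuousAt_const (y := y i)).congr ?_ |>.continuousWithinAt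
        filter_upwards [Iio_mem_nhds ht] with r hr
        simp [hθ', mem_Iio.1 hr]
      · have hc : ContinuousWithinAt (fun r => θ i (r - d)) (Ici t) t :=
          ContinuousWithinAt.comp (f := fun r => r - d) (hθc i (t - d))
            (by fun_prop) fun r hr => sub_le_sub_right (mem_Ici.1 hr) d
        exact hc.congr (fun r hr => if_neg (not_lt.2 ((not_lt.1 ht).trans hr))) (if_neg ht)
    refine ⟨θ', T', fun i t => ?_, fun t => ?_, hcts, fun i => ?_, fun i t ht => ?_, fun i => ?_,
      fun i hi => ?_, ?_⟩
    · simp only [hθ']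
      split_ifs
      exacts [hy.1 i, hθ0 _ _]
    · by_cases ht : t < d
      · simp only [hθ', ht, if_true]
        refine le_trans (le_of_eq ?_) hy.2.2
        rw [← sum_ite_lt_fin hk]
        refine Finset.sum_congr rfl fun i _ => ?_
        split_ifs with hi
        exacts [rfl, hyz i (by omega)]
      · simpa only [hθ', ht, if_false] using hθB (t - d)
    · simp only [hT']
      split_ifs
      exacts [add_nonneg (hT0 i) hd0, by simpa using hT0 i]
    · simp only [hT'] at ht
      simp only [hθ']
      by_cases hi : (i : ℕ) < k + 1
      · rw [if_pos hi] at ht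
        rw [if_neg (by linarith [hT0 i])]
        exact hθT i _ (by linarith)
      · split_ifs with htd
        · exact hyz i (by omega)
        -- At `t = d` the delayed schedule is read at time `0 = T i`, so vanishing is needed at `T
        -- i` itself, not just after it.
        · refine hθT i _ ?_
          rw [hTz i (by omega)]
          linarith
    · by_cases hi : (i : ℕ) < k + 1
      · have hT'i : T' i = T i + d := by simp only [hT', if_pos hi]
        have h1 : EqOn (fun t => s (θ' i t)) (fun _ => s (y i)) (Ioo 0 d) := fun t ht => by
          simp [hθ', ht.2]
        have h2 : EqOn (fun t => s (θ' i t)) (fun t => s (θ i (t - d))) (uIcc d (T i + d)) :=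
          fun t ht => by
            rw [uIcc_of_le (by linarith [hT0 i])] at ht
            simp [hθ', not_lt.2 ht.1]
        have hI : ∀ t > 0, θ' i t ∈ Icc 0 B := fun t _ => by
          simp only [hθ']
          split_ifs
          · exact hyI i
          · exact ⟨hθ0 _ _, (Finset.single_le_sum (f := fun j => θ j (t - d))
              (fun j _ => hθ0 j _) (Finset.mem_univ i)).trans (hθB _)⟩
        have hii : ∀ {S : ℝ}, 0 ≤ S → IntervalIntegrable (fun t => s (θ' i t)) volume 0 S :=
          fun hS => hs.intervalIntegrable_comp (fun t _ => hcts i t) hI hS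
        have hTd : 0 ≤ T i + d := add_nonneg (hT0 i) hd0
        rw [hT'i, ← intervalIntegral.integral_add_adjacent_intervals (hii hd0)
          ((hii hd0).symm.trans (hii hTd)), intervalIntegral.integral_congr h2,
          intervalIntegral.integral_comp_sub_right (fun t => s (θ i t)) d, sub_self,
          add_sub_cancel_right, hserv i, intervalIntegral.integral_of_le hd0,
          integral_Ioc_eq_integral_Ioo, setIntegral_congr_fun measurableSet_Ioo h1]
        simp [hd0, hx']
      · have hT'i : T' i = 0 := by simp only [hT', if_neg hi, hTz i (by omega), add_zero]
        rw [hT'i, intervalIntegral.integral_same, hxz i (by omega)]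
    · simp only [hT', if_neg (show ¬ (i : ℕ) < k + 1 by omega), hTz i (by omega), add_zero]
    · have hl : ∑ i : Fin M, w i * T' i = ∑ i : Fin M, w i * T i + d * ∑ i ∈ Finset.range (k + 1), w i := by
        rw [← sum_ite_lt_fin hk, Finset.mul_sum, ← Finset.sum_add_distrib]
        refine Finset.sum_congr rfl fun i _ => ?_
        simp only [hT']
        split_ifs <;> ring
      have hr : ∑ i : Fin M, a i * x i =
          ∑ i : Fin M, a i * x' i + d * weightedRate s a (k + 1) y := by
        rw [weightedRate, ← sum_ite_lt_fin hk (fun i => a i * s (y i)), Finset.mul_sum,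
          ← Finset.sum_add_distrib]
        refine Finset.sum_congr rfl fun i _ => ?_
        simp only [hx']
        split_ifs with hi
        · ring
        · rw [hyz i (by omega), hs.map_zero]; ring
      rw [hl, hr, hobj, hyW]

theorem proposition9 (M : ℕ) (B : ℝ) (hB : 0 < B) (s : ℝ → ℝ) (hs : IsSpeedup B s)
    (w : Fin M → ℝ) (hw_pos : ∀ i, 0 < w i) (hw : Monotone w) :
    ∃ a : Fin M → ℝ, StrictMono a ∧
      ∀ x : Fin M → ℝ, (∀ i, 0 ≤ x i) → Antitone x →
        IsLeast (objectiveValues B s w x) (∑ i, a i * x i) := by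
  obtain ⟨v, hv_pos, hv, hvw⟩ : ∃ v : ℕ → ℝ, (∀ i, 0 < v i) ∧ Monotone v ∧
      ∀ i : Fin M, v i = w i := by
    rcases M with _ | n
    · exact ⟨fun _ => 1, fun _ => one_pos, monotone_const, fun i => i.elim0⟩
    -- Extend the weights to all of `ℕ` by repeating the last one.
    · refine ⟨fun i => w ⟨min i n, by omega⟩, fun i => hw_pos _, fun i j hij => hw ?_,
        fun i => congrArg w (Fin.ext ?_)⟩
      · exact min_le_min_right n hij
      · exact min_eq_left (Nat.lt_succ_iff.1 i.2)
  obtain ⟨a, -, hsucc, hmax⟩ := exists_coefficients hB hs hv_pos hv M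
  have hlt : ∀ i j, i < j → j < M → a i < a j := fun i j hij hj => by
    induction j, hij using Nat.le_induction with
    | base => exact hsucc i hj
    | succ j _ ih => exact (ih (by omega)).trans (hsucc j hj)
  have hstrict : StrictMono fun i : Fin M => a i := fun i j hij => hlt i j hij j.2
  refine ⟨fun i => a i, hstrict, fun x hx hxa => ⟨?_, ?_⟩⟩
  · obtain ⟨θ, T, h0, hsum, hc, hT, hafter, hserv, -, hobj⟩ :=
      exists_schedule hB hs hv_pos hlt hmax M le_rfl x hx hxa fun i hi => absurd i.2 (not_lt.2 hi)
    refine ⟨θ, T, ⟨fun i t _ => h0 i t, fun t _ => hsum t, fun i t _ => hc i t, hT,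
      fun i t ht => hafter i t (le_of_lt ht), hserv⟩, ?_⟩
    rw [← hobj]
    exact Finset.sum_congr rfl fun i _ => by rw [hvw]
  · rintro _ ⟨θ, T, hf, rfl⟩
    refine (hf.sum_le hs hv hstrict.monotone
      (fun k hk y hy => (hmax k hk).2 ⟨y, hy, rfl⟩) hxa).trans (le_of_eq ?_)
    exact Finset.sum_congr rfl fun i _ => by rw [hvw]
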